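/- Let $s\ge 1$ be an integer, $N\ge 2$ a real number, and let $\bm c^1,\dots,\bm c^s\in\mathbb Z^2$, $\bm c^n=(c^n_1,c^n_2)$, be such that - $c^n_1\neq 0$ and $c^n_2\ne 0$ for $1\le n\le s$; - $\dfrac{|c^n_2|}{|c^n_1|}\le \dfrac{1}{3^{s+2}s}$ for $1\le n\le s$; - $|c^n_i|<2^{-N}|c^{n+1}_i|$ for $1\le n\le s-1$ and $i\in\{1,2\}$. Then every $\bm q\in\mathbb Z^2$ has at most one representation $\bm q=\sum_{j=1}^s\zeta_j\bm c^j$ with $\zeta_j\in\{-1,0,1\}$. Let $\Lambda_s$ be the set of all $\bm q\ne 0$ having such a representation, and for $\bm q\in\Lambda_s$ let $\chi(\bm q)$ be the number of $j$ with $\zeta_j\ne 0$. Put $g(t)=\max\{1-|t|,0\}^2$ for $t\in\mathbb R$, $G(\bm\xi)=g(\xi_1)g(\xi_2)$ for $\bm\xi\in\mathbb R^2$, and, for an integer $\theta\ge1$, $$H^\theta(\bm\xi)=\sum_{\bm q\in\Lambda_s}2^{-\chi(\bm q)}\,G\bigl(2^\theta(\bm\xi-\bm q)\bigr),\qquad \bm\xi\in\mathbb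 R^2 .$$ There is an absolute constant $C$ such that for every $s\ge1$ there is an integer $\theta=\theta(s)\ge1$ such that, for all $N\ge2$ and all $\bm c^1,\dots,\bm c^s$ as above, the function $\frac{\xi_2}{\xi_1}H^\theta(\bm\xi)$ is integrable on $\mathbb R^2$, its inverse Fourier transform $\mathscr F^{-1}f(\bm x)=\int_{\mathbb R^2}f(\bm\xi)e^{2\pi i\langle \bm x,\bm\xi\rangle}\,d\bm\xi$ belongs to $L^1(\mathbb R^2)$, and $$\Bigl\|\mathscr F^{-1}\Bigl(\frac{\xi_2}{\xi_1}H^\theta\Bigr)\Bigr\|_{L^1(\mathbb R^2)}\le C .$$ -/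

import Mathlib

open MeasureTheory
open scoped FourierTransform

noncomputable section

namespace RieszBump

/-- The plane `ℝ²` with its Euclidean structure; `ξ 0`, `ξ 1` are the coordinates `ξ₁`, `ξ₂`. -/
abbrev Plane : Type := EuclideanSpace ℝ (Fin 2)

/-- A lattice point of `ℤ²`, seen in the plane. -/
def toPlane (q : Fin 2 → ℤ) : Plane := WithLp.toLp 2 fun i => (q i : ℝ)

/-- Conditions on the frequencies `c¹, …, cˢ ∈ ℤ²` (indexed here by `0, …, s - 1`). -/
structure Admissible (s : ℕ) (N : ℝ) (c : Fin s → Fin 2 → ℤ) : Prop where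
  /-- No frequency lies on a coordinate axis. -/
  off_axes : ∀ n i, c n i ≠ 0
  /-- The frequencies are concentrated near the first coordinate axis. -/
  slope : ∀ n, |(c n 1 : ℝ)| / |(c n 0 : ℝ)| ≤ 1 / (3 ^ (s + 2) * (s : ℝ))
  /-- Both coordinates are lacunary. -/
  lacunary : ∀ n m : Fin s, (m : ℕ) = (n : ℕ) + 1 →
    ∀ i, |(c n i : ℝ)| < (2 : ℝ) ^ (-N) * |(c m i : ℝ)|

/-- The combination `∑ ζⱼ cʲ` with coefficients `ζⱼ ∈ {-1, 0, 1}`. -/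
def comb {s : ℕ} (c : Fin s → Fin 2 → ℤ) (ζ : Fin s → SignType) : Fin 2 → ℤ :=
  ∑ j, (ζ j : ℤ) • c j

/-- The set `Λₛ` of all non-zero combinations `∑ ζⱼ cʲ`, `ζⱼ ∈ {-1, 0, 1}`. -/
def Lam {s : ℕ} (c : Fin s → Fin 2 → ℤ) : Finset (Fin 2 → ℤ) :=
  (Finset.univ.image (comb c)).erase 0

open Classical in
/-- The number `χ(q)` of non-zero coefficients in the representation `q = ∑ ζⱼ cʲ`
(which is unique for admissible frequencies). -/
def chi {s : ℕ} (c : Fin s → Fin 2 → ℤ) (q : Fin 2 → ℤ) : ℕ :=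
  if h : ∃ ζ, comb c ζ = q then (Finset.univ.filter fun j => h.choose j ≠ 0).card else 0

/-- `g(t) = max{1 - |t|, 0}²`. -/
def g (t : ℝ) : ℝ := (max (1 - |t|) 0) ^ 2

/-- `G(ξ) = g(ξ₁) g(ξ₂)`. -/
def G (ξ : Plane) : ℝ := g (ξ 0) * g (ξ 1)

/-- `H^θ(ξ) = ∑_{q ∈ Λₛ} 2^{-χ(q)} G(2^θ (ξ - q))`. -/
def H {s : ℕ} (c : Fin s → Fin 2 → ℤ) (θ : ℕ) (ξ : Plane) : ℝ :=
  ∑ q ∈ Lam c, 1 / 2 ^ chi c q * G ((2 : ℝ) ^ θ • (ξ - toPlane q))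

/-- The function `(ξ₂ / ξ₁) H^θ(ξ)`, with complex values. -/
def ratioH {s : ℕ} (c : Fin s → Fin 2 → ℤ) (θ : ℕ) (ξ : Plane) : ℂ :=
  ((ξ 1 / ξ 0 * H c θ ξ : ℝ) : ℂ)

end RieszBump

end

/-!
The `L¹` norm of the inverse Fourier transform is invariant under affine substitutions `r • (ξ - q)`
and multiplicative on tensor products. The term of `(ξ₂ / ξ₁) H^θ` at `q` splits, in the coordinates
of its own bump, into the one-dimensional factors `g(t) / (q₁ + 2^{-θ} t)` and
`(q₂ + 2^{-θ} t) g(t)`. Each is a `C²` function times `g`. Two integrations by parts on either side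
of the kink of `g`, where the boundary terms of first order cancel, bound its transform by a
multiple of `(1 + x²)⁻¹`, so that the term at `q` has norm `≲ (|q₂| + 1) / |q₁|`.

By lacunarity `q` is comparable, in both coordinates, with the last frequency occurring in it. Hence
each term has norm `≲ 2^{-s}`, while the weights `2^{-χ(q)}` add up to at most
`∑_ζ ∏ⱼ 2^{-|ζⱼ|} = (1 + 1/2 + 1/2)^s = 2^s`.
-/

namespace RieszBump

open Real (pi)

section FourierL1Bound

variable {V : Type*} [NormedAddCommGroup V] [InnerProductSpace ℝ V] [MeasurableSpace V]
  [BorelSpace V] [FiniteDimensional ℝ V]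

lemma continuous_fourierInv_of_integrable {f : V → ℂ} (hf : Integrable f) :
    Continuous (𝓕⁻ f) := by
  rw [Real.fourierInv_eq_fourier_comp_neg]
  exact VectorFourier.fourierIntegral_continuous Real.continuous_fourierChar
    (L := innerₗ V) continuous_inner hf.comp_neg

/-- `f` is integrable, and its norm in the Fourier algebra, the `L¹` norm of its inverse Fourier
transform, is finite and at most `B`. -/
structure HasFourierL1Bound (f : V → ℂ) (B : ℝ) : Prop where
  integrable : Integrable f
  integrable_fourierInv : Integrable (𝓕⁻ f)
  integral_norm_le : ∫ x, ‖𝓕⁻ f x‖ ≤ B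

namespace HasFourierL1Bound

variable {f₁ f₂ f : V → ℂ} {B₁ B₂ B B' : ℝ}

lemma mono (hf : HasFourierL1Bound f B) (h : B ≤ B') : HasFourierL1Bound f B' :=
  ⟨hf.1, hf.2, hf.3.trans h⟩

lemma zero : HasFourierL1Bound (0 : V → ℂ) 0 := by
  have h : 𝓕⁻ (0 : V → ℂ) = 0 := funext fun x => by simp [Real.fourierInv_eq]
  exact ⟨integrable_zero _ _ _, by rw [h]; exact integrable_zero _ _ _, by simp [h]⟩

lemma add (h₁ : HasFourierL1Bound f₁ B₁) (h₂ : HasFourierL1Bound f₂ B₂) :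
    HasFourierL1Bound (f₁ + f₂) (B₁ + B₂) := by
  have h : 𝓕⁻ (f₁ + f₂) = 𝓕⁻ f₁ + 𝓕⁻ f₂ :=
    VectorFourier.fourierIntegral_add Real.continuous_fourierChar (L := -innerₗ V)
      continuous_inner.neg h₁.integrable h₂.integrable
  have hint := h₁.integrable_fourierInv.add h₂.integrable_fourierInv
  refine ⟨h₁.integrable.add h₂.integrable, h ▸ hint, ?_⟩
  calc ∫ x, ‖𝓕⁻ (f₁ + f₂) x‖ ≤ ∫ x, (‖𝓕⁻ f₁ x‖ + ‖𝓕⁻ f₂ x‖) := by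
        rw [h]
        exact integral_mono hint.norm
          (h₁.integrable_fourierInv.norm.add h₂.integrable_fourierInv.norm) fun x => norm_add_le _ _
    _ = (∫ x, ‖𝓕⁻ f₁ x‖) + ∫ x, ‖𝓕⁻ f₂ x‖ :=
        integral_add h₁.integrable_fourierInv.norm h₂.integrable_fourierInv.norm
    _ ≤ B₁ + B₂ := add_le_add h₁.integral_norm_le h₂.integral_norm_le

lemma const_smul (hf : HasFourierL1Bound f B) (a : ℂ) : HasFourierL1Bound (a • f) (‖a‖ * B) := by
  have h : 𝓕⁻ (a • f) = a • 𝓕⁻ f := VectorFourier.fourierIntegral_const_smul _ _ _ _ _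
  refine ⟨hf.integrable.smul a, h ▸ hf.integrable_fourierInv.smul a, ?_⟩
  simp only [h, Pi.smul_apply, norm_smul, integral_const_mul]
  exact mul_le_mul_of_nonneg_left hf.integral_norm_le (norm_nonneg a)

lemma sum {ι : Type*} {S : Finset ι} {F : ι → V → ℂ} {b : ι → ℝ}
    (h : ∀ i ∈ S, HasFourierL1Bound (F i) (b i)) :
    HasFourierL1Bound (∑ i ∈ S, F i) (∑ i ∈ S, b i) := by
  classical
  induction S using Finset.induction_on with
  | empty => simpa only [Finset.sum_empty] using zero
  | insert i S hi ih =>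
    rw [Finset.sum_insert hi, Finset.sum_insert hi]
    exact (h i (Finset.mem_insert_self i S)).add
      (ih fun j hj => h j (Finset.mem_insert_of_mem hj))

end HasFourierL1Bound

lemma fourierInv_comp_smul_sub {r : ℝ} (hr : r ≠ 0) (f : V → ℂ) (q x : V) :
    𝓕⁻ (fun ξ => f (r • (ξ - q))) x =
      |(r ^ Module.finrank ℝ V)⁻¹| • Real.fourierChar (inner ℝ q x) • 𝓕⁻ f (r⁻¹ • x) := by
  let h : V → ℂ := fun η =>
    Real.fourierChar (inner ℝ q x) • Real.fourierChar (inner ℝ η (r⁻¹ • x)) • f η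
  have hphase (ξ : V) : Real.fourierChar (inner ℝ ξ x) • f (r • (ξ - q)) = h (r • (ξ - q)) := by
    simp only [h, smul_smul, ← AddChar.map_add_eq_mul, real_inner_smul_left, real_inner_smul_right,
      inner_sub_left]
    rw [inv_mul_cancel_left₀ hr, add_sub_cancel]
  calc 𝓕⁻ (fun ξ => f (r • (ξ - q))) x = ∫ ξ, h (r • (ξ - q)) := by
        simp only [Real.fourierInv_eq, hphase]
    _ = ∫ ξ, h (r • ξ) := integral_sub_right_eq_self (fun ξ => h (r • ξ)) q
    _ = |(r ^ Module.finrank ℝ V)⁻¹| • ∫ η, h η := Measure.integral_comp_smul volume h r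
    _ = _ := by simp only [h, Real.fourierInv_eq, Circle.smul_def, integral_smul]

lemma HasFourierL1Bound.comp_smul_sub {f : V → ℂ} {B : ℝ} (hf : HasFourierL1Bound f B) {r : ℝ}
    (hr : r ≠ 0) (q : V) : HasFourierL1Bound (fun ξ => f (r • (ξ - q))) B := by
  have hnorm : ∀ x, ‖𝓕⁻ (fun ξ => f (r • (ξ - q))) x‖ =
      |(r ^ Module.finrank ℝ V)⁻¹| * ‖𝓕⁻ f (r⁻¹ • x)‖ := fun x => by
    rw [fourierInv_comp_smul_sub hr, norm_smul, Circle.norm_smul, Real.norm_eq_abs, abs_abs]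
  have hint : Integrable fun ξ => f (r • (ξ - q)) :=
    (hf.integrable.comp_smul hr).comp_sub_right q
  refine ⟨hint, ?_, ?_⟩
  · rw [← integrable_norm_iff (continuous_fourierInv_of_integrable hint).aestronglyMeasurable]
    simp only [hnorm]
    exact (hf.integrable_fourierInv.comp_smul (inv_ne_zero hr)).norm.const_mul _
  · simp only [hnorm]
    rw [integral_const_mul, Measure.integral_comp_inv_smul volume (fun x => ‖𝓕⁻ f x‖), smul_eq_mul,
      ← mul_assoc, ← abs_mul, inv_mul_cancel₀ (pow_ne_zero _ hr), abs_one, one_mul]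
    exact hf.integral_norm_le

end FourierL1Bound

section Tensor

variable {ι : Type*} [Fintype ι] {f : ι → ℝ → ℂ}

lemma integrable_prod_coord (hf : ∀ i, Integrable (f i)) :
    Integrable fun ξ : EuclideanSpace ℝ ι => ∏ i, f i (ξ i) :=
  (PiLp.volume_preserving_ofLp ι).integrable_comp_of_integrable (Integrable.fintype_prod hf)

lemma integral_prod_coord {𝕜 : Type*} [RCLike 𝕜] (f : ι → ℝ → 𝕜) :
    ∫ ξ : EuclideanSpace ℝ ι, ∏ i, f i (ξ i) = ∏ i, ∫ t, f i t := by
  rw [← integral_fintype_prod_volume_eq_prod,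
    ← (EuclideanSpace.volume_preserving_symm_measurableEquiv_toLp ι).integral_comp']
  rfl

lemma fourierInv_prod_coord (f : ι → ℝ → ℂ) (x : EuclideanSpace ℝ ι) :
    𝓕⁻ (fun ξ : EuclideanSpace ℝ ι => ∏ i, f i (ξ i)) x = ∏ i, 𝓕⁻ (f i) (x i) := by
  simp only [Real.fourierInv_eq']
  rw [← integral_prod_coord]
  refine integral_congr_ae (Filter.Eventually.of_forall fun ξ => ?_)
  simp only [smul_eq_mul, Finset.prod_mul_distrib, ← Complex.exp_sum, PiLp.inner_apply]
  congr 2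
  rw [← Finset.sum_mul, ← Complex.ofReal_sum, Finset.mul_sum]

lemma HasFourierL1Bound.prod_coord {B : ι → ℝ} (hf : ∀ i, HasFourierL1Bound (f i) (B i)) :
    HasFourierL1Bound (fun ξ : EuclideanSpace ℝ ι => ∏ i, f i (ξ i)) (∏ i, B i) where
  integrable := integrable_prod_coord fun i => (hf i).integrable
  integrable_fourierInv := by
    rw [funext (fourierInv_prod_coord f)]
    exact integrable_prod_coord fun i => (hf i).integrable_fourierInv
  integral_norm_le := by
    simp only [fourierInv_prod_coord, norm_prod]
    rw [integral_prod_coord fun i t => ‖𝓕⁻ (f i) t‖]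
    exact Finset.prod_le_prod (fun i _ => integral_nonneg fun _ => norm_nonneg _)
      fun i _ => (hf i).integral_norm_le

end Tensor

lemma hasFourierL1Bound_of_norm_fourierInv_le {f : ℝ → ℂ} {K : ℝ} (hf : Integrable f)
    (hK : ∀ x, ‖𝓕⁻ f x‖ ≤ K * (1 + x ^ 2)⁻¹) : HasFourierL1Bound f (K * pi) := by
  have hdom : Integrable fun x : ℝ => K * (1 + x ^ 2)⁻¹ := integrable_inv_one_add_sq.const_mul K
  have hF : Integrable (𝓕⁻ f) := hdom.mono'
    (continuous_fourierInv_of_integrable hf).aestronglyMeasurable (Filter.Eventually.of_forall hK)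
  refine ⟨hf, hF, (integral_mono hF.norm hdom hK).trans_eq ?_⟩
  rw [integral_const_mul, integral_univ_inv_one_add_sq]

section C2BoundedOn

variable {E A : Type*} [NormedAddCommGroup E] [NormedSpace ℝ E] [NormedRing A] [NormedAlgebra ℝ A]

/-- On the set `s` the function `φ` is twice continuously differentiable, and `φ`, `φ'`, `φ''` are
bounded by `M` there. The derivatives are two-sided at every point of `s`. -/
def C2BoundedOn (φ : ℝ → E) (s : Set ℝ) (M : ℝ) : Prop :=
  ∃ φ' φ'' : ℝ → E, ContinuousOn φ'' s ∧ ∀ t ∈ s, HasDerivAt φ (φ' t) t ∧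
    HasDerivAt φ' (φ'' t) t ∧ ‖φ t‖ ≤ M ∧ ‖φ' t‖ ≤ M ∧ ‖φ'' t‖ ≤ M

namespace C2BoundedOn

variable {φ : ℝ → E} {s s' : Set ℝ} {M : ℝ}

lemma mono (h : C2BoundedOn φ s M) (hs : s' ⊆ s) : C2BoundedOn φ s' M :=
  let ⟨φ', φ'', hcont, hφ⟩ := h
  ⟨φ', φ'', hcont.mono hs, fun t ht => hφ t (hs ht)⟩

lemma continuousOn (h : C2BoundedOn φ s M) : ContinuousOn φ s :=
  let ⟨_, _, _, hφ⟩ := h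
  fun t ht => (hφ t ht).1.continuousAt.continuousWithinAt

lemma norm_le (h : C2BoundedOn φ s M) {t : ℝ} (ht : t ∈ s) : ‖φ t‖ ≤ M :=
  let ⟨_, _, _, hφ⟩ := h
  (hφ t ht).2.2.1

lemma comp_neg (h : C2BoundedOn φ s M) : C2BoundedOn (fun t => φ (-t)) (-s) M := by
  obtain ⟨φ', φ'', hcont, hφ⟩ := h
  refine ⟨fun t => -φ' (-t), fun t => φ'' (-t),
    hcont.comp continuousOn_neg fun t ht => ht, fun t ht => ?_⟩
  obtain ⟨h₁, h₂, b₀, b₁, b₂⟩ := hφ (-t) ht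
  refine ⟨?_, ?_, b₀, (norm_neg _).trans_le b₁, b₂⟩
  · simpa [Function.comp_def] using h₁.scomp t (hasDerivAt_neg t)
  · simpa [Function.comp_def] using (h₂.scomp t (hasDerivAt_neg t)).fun_neg

lemma mul {φ ψ : ℝ → A} {L : ℝ} (hφ : C2BoundedOn φ s M) (hψ : C2BoundedOn ψ s L) :
    C2BoundedOn (fun t => φ t * ψ t) s (4 * (M * L)) := by
  have norm_mul_le_mul {a b : A} (ha : ‖a‖ ≤ M) (hb : ‖b‖ ≤ L) : ‖a * b‖ ≤ M * L :=
    norm_mul_le_of_le ha hb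
  have hφc := hφ.continuousOn
  have hψc := hψ.continuousOn
  obtain ⟨φ', φ'', hφcont, hφ⟩ := hφ
  obtain ⟨ψ', ψ'', hψcont, hψ⟩ := hψ
  have hφ'c : ContinuousOn φ' s := fun t ht => (hφ t ht).2.1.continuousAt.continuousWithinAt
  have hψ'c : ContinuousOn ψ' s := fun t ht => (hψ t ht).2.1.continuousAt.continuousWithinAt
  refine ⟨fun t => φ' t * ψ t + φ t * ψ' t,
    fun t => φ'' t * ψ t + φ' t * ψ' t + (φ' t * ψ' t + φ t * ψ'' t),
    by fun_prop, fun t ht => ?_⟩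
  obtain ⟨h₁, h₂, b₀, b₁, b₂⟩ := hφ t ht
  obtain ⟨k₁, k₂, l₀, l₁, l₂⟩ := hψ t ht
  have hML : 0 ≤ M * L := (norm_nonneg _).trans (norm_mul_le_mul b₀ l₀)
  refine ⟨h₁.mul k₁, (h₂.mul k₁).add (h₁.mul k₂), ?_, ?_, ?_⟩
  · linarith [norm_mul_le_mul b₀ l₀]
  · linarith [norm_add_le_of_le (norm_mul_le_mul b₁ l₀) (norm_mul_le_mul b₀ l₁)]
  · linarith [norm_add_le_of_le
      (norm_add_le_of_le (norm_mul_le_mul b₂ l₀) (norm_mul_le_mul b₁ l₁))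
      (norm_add_le_of_le (norm_mul_le_mul b₁ l₁) (norm_mul_le_mul b₀ l₂))]

lemma ofReal {φ : ℝ → ℝ} (h : C2BoundedOn φ s M) : C2BoundedOn (fun t => (φ t : ℂ)) s M := by
  obtain ⟨φ', φ'', hcont, hφ⟩ := h
  refine ⟨fun t => φ' t, fun t => φ'' t, Complex.continuous_ofReal.comp_continuousOn hcont,
    fun t ht => ?_⟩
  simp only [Complex.norm_real]
  exact ⟨(hφ t ht).1.ofReal_comp, (hφ t ht).2.1.ofReal_comp, (hφ t ht).2.2⟩

end C2BoundedOn

lemma c2BoundedOn_affine {a b : ℝ} (hb : |b| ≤ 1) :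
    C2BoundedOn (fun t => a + b * t) (Set.Icc (-1) 1) (|a| + 1) := by
  refine ⟨fun _ => b, fun _ => 0, continuousOn_const, fun t ht => ⟨?_, hasDerivAt_const t b, ?_⟩⟩
  · simpa using ((hasDerivAt_id t).const_mul b).const_add a
  · have hbt : |b * t| ≤ 1 := by
      rw [abs_mul]
      exact mul_le_one₀ hb (abs_nonneg t) (abs_le.mpr ht)
    simp only [Real.norm_eq_abs, abs_zero]
    have := abs_nonneg a
    exact ⟨(abs_add_le _ _).trans (by linarith), by linarith, by linarith⟩

lemma half_abs_le_abs_affine {a b t : ℝ} (ha : 1 ≤ |a|) (hb : |b| ≤ 1 / 2) (ht : |t| ≤ 1) :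
    |a| / 2 ≤ |a + b * t| := by
  have hbt : |b * t| ≤ 1 / 2 * 1 := by
    rw [abs_mul]
    exact mul_le_mul hb ht (abs_nonneg t) (by norm_num)
  linarith [abs_sub_abs_le_abs_add a (b * t)]

lemma c2BoundedOn_inv_affine {a b : ℝ} (ha : 1 ≤ |a|) (hb : |b| ≤ 1 / 2) :
    C2BoundedOn (fun t => (a + b * t)⁻¹) (Set.Icc (-1) 1) (4 / |a|) := by
  have hlow : ∀ t ∈ Set.Icc (-1 : ℝ) 1, |a| / 2 ≤ |a + b * t| := fun t ht =>
    half_abs_le_abs_affine ha hb (abs_le.mpr ht)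
  have hne : ∀ t ∈ Set.Icc (-1 : ℝ) 1, a + b * t ≠ 0 := fun t ht =>
    abs_pos.mp (by linarith [hlow t ht])
  have hlin : ∀ t, HasDerivAt (fun t => a + b * t) b t := fun t => by
    simpa using ((hasDerivAt_id t).const_mul b).const_add a
  have hpos : 0 ≤ 2 / |a| := by positivity
  have hle : 2 / |a| ≤ 2 := div_le_self zero_le_two ha
  have hfour : 4 / |a| = 2 * (2 / |a|) := by ring
  refine ⟨fun t => -b * ((a + b * t)⁻¹) ^ 2, fun t => 2 * b ^ 2 * ((a + b * t)⁻¹) ^ 3,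
    ?_, fun t ht => ?_⟩
  · have := ContinuousOn.inv₀ (f := fun t => a + b * t) (by fun_prop) hne
    fun_prop
  have hinv : |(a + b * t)⁻¹| ≤ 2 / |a| := by
    rw [abs_inv, ← inv_div]
    exact inv_anti₀ (by linarith) (hlow t ht)
  have hderiv := (hlin t).inv (hne t ht)
  simp only [Real.norm_eq_abs, hfour]
  refine ⟨?_, ?_, by linarith, ?_, ?_⟩
  · convert! hderiv using 1
    rw [inv_pow, div_eq_mul_inv]
  · convert! (hderiv.pow 2).const_mul (-b) using 1
    have := hne t ht
    simp only [Pi.inv_apply]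
    push_cast
    field_simp
  · rw [abs_mul, abs_neg, abs_pow]
    calc |b| * |(a + b * t)⁻¹| ^ 2 ≤ 1 / 2 * (2 / |a|) ^ 2 := by gcongr
      _ ≤ 2 * (2 / |a|) := by nlinarith
  · rw [abs_mul, abs_mul, abs_two, abs_pow, abs_pow]
    calc 2 * |b| ^ 2 * |(a + b * t)⁻¹| ^ 3 ≤ 2 * (1 / 2) ^ 2 * (2 / |a|) ^ 3 := by gcongr
      _ = 1 / 2 * (2 / |a|) * (2 / |a|) ^ 2 := by ring
      _ ≤ 1 / 2 * (2 / |a|) * 2 ^ 2 := by gcongr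
      _ = 2 * (2 / |a|) := by ring

lemma c2BoundedOn_one_sub_sq : C2BoundedOn (fun t : ℝ => (1 - t : ℂ) ^ 2) (Set.Icc 0 1) 2 := by
  have h : C2BoundedOn (fun t : ℝ => (1 - t) ^ 2) (Set.Icc 0 1) 2 := by
    refine ⟨fun t => -2 * (1 - t), fun _ => 2, continuousOn_const, fun t ht => ?_⟩
    have hlin : HasDerivAt (fun t : ℝ => 1 - t) (-1) t := (hasDerivAt_id t).const_sub 1
    simp only [Real.norm_eq_abs, abs_le]
    refine ⟨?_, ?_, ?_⟩
    · convert! hlin.pow 2 using 1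
      push_cast
      ring
    · convert! hlin.const_mul (-2) using 1
      ring
    · refine ⟨⟨?_, ?_⟩, ⟨?_, ?_⟩, ?_, ?_⟩ <;> nlinarith [ht.1, ht.2]
  simpa using h.ofReal

end C2BoundedOn

section Oscillatory

variable {f f' : ℝ → ℂ} {a b M : ℝ} {c : ℂ}

lemma integral_mul_exp_eq (hc : c ≠ 0) (hf : ∀ t ∈ Set.uIcc a b, HasDerivAt f (f' t) t)
    (hf' : ContinuousOn f' (Set.uIcc a b)) :
    ∫ t in a..b, f t * Complex.exp (c * t) =
      (f b * Complex.exp (c * b) - f a * Complex.exp (c * a)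
        - ∫ t in a..b, f' t * Complex.exp (c * t)) / c := by
  have hexp : ∀ t ∈ Set.uIcc a b,
      HasDerivAt (fun t : ℝ => Complex.exp (c * t)) (Complex.exp (c * t) * c) t := fun t _ => by
    simpa using ((hasDerivAt_id t).ofReal_comp.const_mul c).cexp
  have hparts := intervalIntegral.integral_mul_deriv_eq_deriv_mul hf hexp hf'.intervalIntegrable
    (Continuous.intervalIntegrable (by fun_prop) _ _)
  rw [eq_div_iff hc, ← hparts, ← intervalIntegral.integral_mul_const]
  simp only [mul_assoc]

lemma norm_mul_exp_of_re_eq_zero (hc : c.re = 0) (z : ℂ) (t : ℝ) :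
    ‖z * Complex.exp (c * t)‖ = ‖z‖ := by
  simp [Complex.norm_exp, hc]

lemma norm_integral_mul_exp_le (hab : a ≤ b) (hc : c.re = 0)
    (hM : ∀ t ∈ Set.Icc a b, ‖f t‖ ≤ M) :
    ‖∫ t in a..b, f t * Complex.exp (c * t)‖ ≤ M * (b - a) := by
  rw [← abs_of_nonneg (sub_nonneg.mpr hab)]
  refine intervalIntegral.norm_integral_le_of_norm_le_const fun t ht => ?_
  rw [norm_mul_exp_of_re_eq_zero hc]
  exact hM t (Set.Ioc_subset_Icc_self (Set.uIoc_of_le hab ▸ ht))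

lemma C2BoundedOn.norm_integral_mul_exp_sub_le (hf : C2BoundedOn f (Set.Icc a b) M) (hab : a ≤ b)
    (hc : c ≠ 0) (hre : c.re = 0) :
    ‖(∫ t in a..b, f t * Complex.exp (c * t)) -
        (f b * Complex.exp (c * b) - f a * Complex.exp (c * a)) / c‖
      ≤ M * (2 + (b - a)) / ‖c‖ ^ 2 := by
  obtain ⟨f', f'', hcont, hf⟩ := hf
  have hu : Set.uIcc a b = Set.Icc a b := Set.uIcc_of_le hab
  have hcont' : ContinuousOn f' (Set.Icc a b) := fun t ht =>
    (hf t ht).2.1.continuousAt.continuousWithinAt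
  have parts₁ := integral_mul_exp_eq hc (fun t ht => (hf t (hu ▸ ht)).1) (hu ▸ hcont')
  have parts₂ := integral_mul_exp_eq hc (fun t ht => (hf t (hu ▸ ht)).2.1) (hu ▸ hcont)
  have boundary {t : ℝ} (ht : t ∈ Set.Icc a b) : ‖f' t * Complex.exp (c * t)‖ ≤ M :=
    (norm_mul_exp_of_re_eq_zero hre _ t).trans_le (hf t ht).2.2.2.1
  have remainder : ‖∫ t in a..b, f'' t * Complex.exp (c * t)‖ ≤ M * (b - a) :=
    norm_integral_mul_exp_le hab hre fun t ht => (hf t ht).2.2.2.2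
  rw [parts₁, parts₂, ← sub_div, sub_sub_cancel_left, norm_div, norm_neg, norm_div, div_div, ← sq]
  gcongr
  linarith [norm_sub_le_of_le (norm_sub_le_of_le (boundary (Set.right_mem_Icc.mpr hab))
    (boundary (Set.left_mem_Icc.mpr hab))) remainder]

end Oscillatory

section Bump

lemma continuous_g : Continuous g := by unfold g; fun_prop

lemma g_neg (t : ℝ) : g (-t) = g t := by simp only [g, abs_neg]

lemma g_of_mem_Icc {t : ℝ} (ht : t ∈ Set.Icc (0 : ℝ) 1) : g t = (1 - t) ^ 2 := by
  rw [g, abs_of_nonneg ht.1, max_eq_left (sub_nonneg.mpr ht.2)]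

lemma g_eq_zero_of_notMem_Ioc {t : ℝ} (ht : t ∉ Set.Ioc (-1 : ℝ) 1) : g t = 0 := by
  have h : 1 ≤ |t| := by
    contrapose! ht
    exact ⟨(abs_lt.mp ht).1, (abs_lt.mp ht).2.le⟩
  simp [g, max_eq_right (sub_nonpos.mpr h)]

variable {φ : ℝ → ℂ} {M : ℝ} {c : ℂ}

lemma integrable_mul_g (hφ : ContinuousOn φ (Set.Icc (-1) 1)) :
    Integrable fun t => φ t * g t := by
  rw [← integrableOn_iff_integrable_of_support_subset (s := Set.Icc (-1) 1)]
  · exact (hφ.mul (Complex.continuous_ofReal.comp continuous_g).continuousOn).integrableOn_compact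
      isCompact_Icc
  · refine Function.support_subset_iff'.mpr fun t ht => ?_
    rw [g_eq_zero_of_notMem_Ioc fun h => ht (Set.Ioc_subset_Icc_self h), Complex.ofReal_zero,
      mul_zero]

lemma fourierInv_mul_g_eq_intervalIntegral (φ : ℝ → ℂ) (x : ℝ) :
    𝓕⁻ (fun t => φ t * g t) x =
      ∫ t in (-1)..1, φ t * g t * Complex.exp (2 * pi * x * Complex.I * t) := by
  rw [Real.fourierInv_eq', intervalIntegral.integral_of_le (by norm_num),
    setIntegral_eq_integral_of_forall_compl_eq_zero fun t ht => by
      rw [g_eq_zero_of_notMem_Ioc ht, Complex.ofReal_zero, mul_zero, zero_mul]]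
  refine integral_congr_ae (Filter.Eventually.of_forall fun t => ?_)
  simp only [smul_eq_mul, RCLike.inner_apply, conj_trivial]
  push_cast
  ring_nf

/-- The contribution of the right half of the bump `g` to `∫ φ g exp (c ·)`. -/
noncomputable def halfBumpIntegral (φ : ℝ → ℂ) (c : ℂ) : ℂ :=
  ∫ t in (0 : ℝ)..1, φ t * (1 - t) ^ 2 * Complex.exp (c * t)

lemma integral_mul_g_mul_exp_eq (hφ : ContinuousOn φ (Set.Icc (-1) 1)) :
    ∫ t in (-1)..1, φ t * g t * Complex.exp (c * t) =
      halfBumpIntegral (fun t => φ (-t)) (-c) + halfBumpIntegral φ c := by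
  have hcont : ContinuousOn (fun t => φ t * g t * Complex.exp (c * t)) (Set.Icc (-1) 1) :=
    (hφ.mul (Complex.continuous_ofReal.comp continuous_g).continuousOn).mul (by fun_prop)
  have right : ∫ t in (0 : ℝ)..1, φ t * g t * Complex.exp (c * t) = halfBumpIntegral φ c := by
    refine intervalIntegral.integral_congr fun t ht => ?_
    simp only [g_of_mem_Icc (Set.uIcc_of_le (zero_le_one' ℝ) ▸ ht)]
    push_cast
    rfl
  have left : ∫ t in (-1 : ℝ)..0, φ t * g t * Complex.exp (c * t) =
      halfBumpIntegral (fun t => φ (-t)) (-c) := by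
    rw [← neg_zero, ← intervalIntegral.integral_comp_neg]
    refine intervalIntegral.integral_congr fun t ht => ?_
    simp only [g_neg, g_of_mem_Icc (Set.uIcc_of_le (zero_le_one' ℝ) ▸ ht)]
    push_cast
    rw [mul_neg, neg_mul]
  rw [← left, ← right, intervalIntegral.integral_add_adjacent_intervals]
  · exact (hcont.mono (Set.Icc_subset_Icc_right zero_le_one)).intervalIntegrable_of_Icc
      (by norm_num)
  · exact (hcont.mono (Set.Icc_subset_Icc_left (by norm_num))).intervalIntegrable_of_Icc zero_le_one

lemma norm_halfBumpIntegral_le (hφ : ∀ t ∈ Set.Icc (0 : ℝ) 1, ‖φ t‖ ≤ M) (hc : c.re = 0) :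
    ‖halfBumpIntegral φ c‖ ≤ M := by
  refine (norm_integral_mul_exp_le zero_le_one hc fun t ht => ?_).trans_eq
    (by rw [sub_zero, mul_one])
  have hsq : ‖(1 - t : ℂ) ^ 2‖ ≤ 1 := by
    rw [← Complex.ofReal_one, ← Complex.ofReal_sub, norm_pow, Complex.norm_real, Real.norm_eq_abs,
      abs_of_nonneg (sub_nonneg.mpr ht.2)]
    exact pow_le_one₀ (sub_nonneg.mpr ht.2) (by linarith [ht.1])
  exact (norm_mul_le_of_le (hφ t ht) hsq).trans_eq (mul_one M)

lemma norm_halfBumpIntegral_add_div_le (hφ : C2BoundedOn φ (Set.Icc 0 1) M) (hc : c ≠ 0)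
    (hre : c.re = 0) : ‖halfBumpIntegral φ c + φ 0 / c‖ ≤ 24 * M / ‖c‖ ^ 2 := by
  have h := (hφ.mul c2BoundedOn_one_sub_sq).norm_integral_mul_exp_sub_le zero_le_one hc hre
  simp only [Complex.ofReal_one, Complex.ofReal_zero, sub_self, ne_eq, OfNat.ofNat_ne_zero,
    not_false_eq_true, zero_pow, mul_zero, zero_mul, sub_zero, one_pow, mul_one, Complex.exp_zero,
    zero_sub, neg_div, sub_neg_eq_add] at h
  exact h.trans_eq (by ring)

/-- The kink of `g` at `0` costs no decay: the boundary terms of the two halves cancel. -/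
lemma norm_integral_mul_g_mul_exp_le (hφ : C2BoundedOn φ (Set.Icc (-1) 1) M) (hc : c ≠ 0)
    (hre : c.re = 0) :
    ‖∫ t in (-1)..1, φ t * g t * Complex.exp (c * t)‖ ≤ 48 * M / ‖c‖ ^ 2 := by
  have hright := norm_halfBumpIntegral_add_div_le
    (hφ.mono (Set.Icc_subset_Icc_left (by norm_num))) hc hre
  have hleft := norm_halfBumpIntegral_add_div_le (φ := fun t => φ (-t)) (c := -c)
    (hφ.comp_neg.mono fun t ht => ⟨by linarith [ht.2], by linarith [ht.1]⟩)
    (neg_ne_zero.mpr hc) (by rw [Complex.neg_re, hre, neg_zero])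
  rw [neg_zero, norm_neg] at hleft
  calc _ = ‖(halfBumpIntegral (fun t => φ (-t)) (-c) + φ 0 / -c) +
        (halfBumpIntegral φ c + φ 0 / c)‖ := by
        rw [integral_mul_g_mul_exp_eq hφ.continuousOn, div_neg]
        ring_nf
    _ ≤ 24 * M / ‖c‖ ^ 2 + 24 * M / ‖c‖ ^ 2 := norm_add_le_of_le hleft hright
    _ = 48 * M / ‖c‖ ^ 2 := by ring

lemma norm_fourierInv_mul_g_le (hφ : C2BoundedOn φ (Set.Icc (-1) 1) M) (x : ℝ) :
    ‖𝓕⁻ (fun t => φ t * g t) x‖ ≤ 4 * M * (1 + x ^ 2)⁻¹ := by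
  set c : ℂ := 2 * pi * x * Complex.I with hc
  have hre : c.re = 0 := by simp [hc]
  have hnorm : ‖c‖ ^ 2 = 4 * pi ^ 2 * x ^ 2 := by
    rw [hc, norm_mul, Complex.norm_I, mul_one, norm_mul, norm_mul, RCLike.norm_ofNat,
      Complex.norm_real, Complex.norm_real, mul_pow, mul_pow, Real.norm_eq_abs, Real.norm_eq_abs,
      sq_abs, sq_abs]
    norm_num
  have hM : 0 ≤ M := (norm_nonneg _).trans (hφ.norm_le (t := 0) (by norm_num))
  rw [fourierInv_mul_g_eq_intervalIntegral, ← div_eq_mul_inv, le_div_iff₀ (by positivity), mul_add,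
    mul_one]
  set J := ∫ t in (-1)..1, φ t * g t * Complex.exp (c * t) with hJ
  have trivial_bound : ‖J‖ ≤ 2 * M := by
    rw [hJ, integral_mul_g_mul_exp_eq hφ.continuousOn, two_mul]
    refine norm_add_le_of_le (norm_halfBumpIntegral_le (fun t ht => hφ.norm_le ?_) (by simp [hre]))
      (norm_halfBumpIntegral_le (fun t ht => hφ.norm_le ?_) hre)
    · exact ⟨by linarith [ht.2], by linarith [ht.1]⟩
    · exact ⟨by linarith [ht.1], ht.2⟩
  have decay : ‖J‖ * x ^ 2 ≤ 2 * M := by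
    rcases eq_or_ne x 0 with rfl | hx
    · simpa using hM
    have h := norm_integral_mul_g_mul_exp_le hφ (c := c) (by simp [hc, hx, Real.pi_ne_zero]) hre
    rw [hnorm, ← hJ, le_div_iff₀ (by positivity)] at h
    have hpi : 9 ≤ pi ^ 2 := by nlinarith [Real.pi_gt_three]
    nlinarith [mul_le_mul_of_nonneg_right hpi (mul_nonneg (norm_nonneg J) (sq_nonneg x))]
  linarith

lemma C2BoundedOn.hasFourierL1Bound_mul_g (hφ : C2BoundedOn φ (Set.Icc (-1) 1) M) :
    HasFourierL1Bound (fun t => φ t * g t) (4 * M * pi) :=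
  hasFourierL1Bound_of_norm_fourierInv_le (integrable_mul_g hφ.continuousOn)
    (norm_fourierInv_mul_g_le hφ)

lemma hasFourierL1Bound_ratio_mul_G {r : ℝ} (hr : 2 ≤ r) {q : Plane} (hq : 1 ≤ |q 0|) :
    HasFourierL1Bound (fun ξ : Plane => ((ξ 1 / ξ 0 * G (r • (ξ - q)) : ℝ) : ℂ))
      (64 * pi ^ 2 * ((|q 1| + 1) / |q 0|)) := by
  have hr0 : r ≠ 0 := by positivity
  have hrinv : |r⁻¹| ≤ 1 / 2 := by
    rw [abs_of_pos (by positivity), ← one_div]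
    exact one_div_le_one_div_of_le two_pos hr
  have first := (c2BoundedOn_inv_affine hq hrinv).ofReal.hasFourierL1Bound_mul_g
  have second := (c2BoundedOn_affine (a := q 1)
    (hrinv.trans (by norm_num))).ofReal.hasFourierL1Bound_mul_g
  have tensor := HasFourierL1Bound.prod_coord (Fin.forall_fin_two.mpr ⟨first, second⟩)
    (f := ![_, _]) (B := ![_, _])
  convert (tensor.comp_smul_sub hr0 q) using 1
  · funext ξ
    have coord (i : Fin 2) : q i + r⁻¹ * (r * (ξ i - q i)) = ξ i := by
      rw [inv_mul_cancel_left₀ hr0, add_sub_cancel]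
    simp only [G, Fin.prod_univ_two, Matrix.cons_val_zero, Matrix.cons_val_one, PiLp.smul_apply,
      PiLp.sub_apply, smul_eq_mul, coord]
    push_cast
    ring
  · simp only [Fin.prod_univ_two, Matrix.cons_val_zero, Matrix.cons_val_one]
    ring

end Bump

section Lacunary

variable {s : ℕ} {ρ : ℝ}

/-- The moduli of `a₀, a₁, …, aₛ₋₁` grow by a factor of at least `ρ` from each index to the next. -/
def LacunaryBy (ρ : ℝ) (a : Fin s → ℝ) : Prop :=
  ∀ n m : Fin s, (m : ℕ) = n + 1 → ρ * |a n| ≤ |a m|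

lemma LacunaryBy.mono {ρ' : ℝ} {a : Fin s → ℝ} (ha : LacunaryBy ρ' a) (h : ρ ≤ ρ') :
    LacunaryBy ρ a := fun n m hnm =>
  (mul_le_mul_of_nonneg_right h (abs_nonneg _)).trans (ha n m hnm)

lemma LacunaryBy.mul_sum_Iio_le {a : Fin s → ℝ} (ha : LacunaryBy ρ a) (j : Fin s) :
    (ρ - 1) * ∑ i ∈ Finset.Iio j, |a i| ≤ |a j| := by
  obtain ⟨k, hk⟩ := j
  induction k with
  | zero =>
    have : Finset.Iio (⟨0, hk⟩ : Fin s) = ∅ := by ext i; simp [Fin.lt_def]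
    simp [this]
  | succ k ih =>
    have hk' : k < s := by omega
    have : Finset.Iio (⟨k + 1, hk⟩ : Fin s) = insert ⟨k, hk'⟩ (Finset.Iio ⟨k, hk'⟩) := by
      ext i
      simp only [Finset.mem_Iio, Finset.mem_insert, Fin.lt_def, Fin.ext_iff]
      omega
    rw [this, Finset.sum_insert (by simp), mul_add]
    linarith [ih hk', ha ⟨k, hk'⟩ ⟨k + 1, hk⟩ rfl]

lemma LacunaryBy.mul_abs_sum_sub_le {a x : Fin s → ℝ} (ha : LacunaryBy ρ a) (hρ : 1 ≤ ρ)
    (hx : ∀ i, |x i| ≤ 1) {j : Fin s} (hj : ∀ i, j < i → x i = 0) :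
    (ρ - 1) * |∑ i, x i * a i - x j * a j| ≤ |a j| := by
  have htail : ∑ i, x i * a i = ∑ i ∈ Finset.Iic j, x i * a i :=
    (Finset.sum_subset (Finset.subset_univ _) fun i _ hi => by
      rw [hj i (by simpa using hi), zero_mul]).symm
  rw [htail, ← Finset.Iio_insert, Finset.sum_insert (by simp), add_sub_cancel_left]
  refine le_trans ?_ (ha.mul_sum_Iio_le j)
  refine mul_le_mul_of_nonneg_left ?_ (sub_nonneg.mpr hρ)
  refine (Finset.abs_sum_le_sum_abs _ _).trans (Finset.sum_le_sum fun i _ => ?_)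
  rw [abs_mul]
  exact mul_le_of_le_one_left (abs_nonneg _) (hx i)

end Lacunary

lemma abs_signType_le_one (σ : SignType) : |((σ : ℤ) : ℝ)| ≤ 1 := by
  cases σ <;> simp

lemma abs_signType_eq_one {σ : SignType} (hσ : σ ≠ 0) : |((σ : ℤ) : ℝ)| = 1 := by
  cases σ <;> simp_all

lemma exists_last_ne_zero {ι α : Type*} [Finite ι] [LinearOrder ι] [Zero α] {f : ι → α}
    (hf : f ≠ 0) : ∃ j, f j ≠ 0 ∧ ∀ i, j < i → f i = 0 := by
  obtain ⟨j, hj, hmax⟩ := (Function.support f).exists_max_image id (Set.toFinite _)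
    (Function.support_nonempty_iff.mpr hf)
  exact ⟨j, hj, fun i hji => by_contra fun hi => (hmax i hi).not_gt hji⟩

section Frequencies

variable {s : ℕ} {c : Fin s → Fin 2 → ℤ} {q : Fin 2 → ℤ} {ρ : ℝ}

lemma cast_comb_apply (c : Fin s → Fin 2 → ℤ) (ζ : Fin s → SignType) (k : Fin 2) :
    (comb c ζ k : ℝ) = ∑ i, ((ζ i : ℤ) : ℝ) * c i k := by
  simp only [comb, Finset.sum_apply, Pi.smul_apply, smul_eq_mul, Int.cast_sum, Int.cast_mul]

lemma exists_comb_eq_of_mem_Lam (hq : q ∈ Lam c) : ∃ ζ ≠ 0, comb c ζ = q := by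
  obtain ⟨hq0, hq⟩ := Finset.mem_erase.mp hq
  obtain ⟨ζ, -, rfl⟩ := Finset.mem_image.mp hq
  refine ⟨ζ, fun h => hq0 ?_, rfl⟩
  simp [h, comb]

lemma exists_coord_comparable_of_mem_Lam (hρ : 1 ≤ ρ)
    (hlac : ∀ k, LacunaryBy ρ fun n => (c n k : ℝ)) (hq : q ∈ Lam c) :
    ∃ j, ∀ k, (ρ - 2) * |(c j k : ℝ)| ≤ (ρ - 1) * |(q k : ℝ)| ∧
      (ρ - 1) * |(q k : ℝ)| ≤ ρ * |(c j k : ℝ)| := by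
  obtain ⟨ζ, hζ, rfl⟩ := exists_comb_eq_of_mem_Lam hq
  obtain ⟨j, hj, hlast⟩ := exists_last_ne_zero hζ
  refine ⟨j, fun k => ?_⟩
  have near := (hlac k).mul_abs_sum_sub_le hρ (fun i => abs_signType_le_one (ζ i)) (j := j)
    fun i hi => by simp [hlast i hi]
  rw [← cast_comb_apply] at near
  have leading : |((ζ j : ℤ) : ℝ) * c j k| = |(c j k : ℝ)| := by
    rw [abs_mul, abs_signType_eq_one hj, one_mul]
  have lower := abs_sub_abs_le_abs_sub (((ζ j : ℤ) : ℝ) * c j k) (comb c ζ k : ℝ)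
  have upper := abs_sub_abs_le_abs_sub (comb c ζ k : ℝ) (((ζ j : ℤ) : ℝ) * c j k)
  rw [leading, abs_sub_comm] at lower
  rw [leading] at upper
  have hρ' := sub_nonneg.mpr hρ
  constructor
  · linarith [mul_le_mul_of_nonneg_left lower hρ']
  · linarith [mul_le_mul_of_nonneg_left upper hρ']

lemma one_le_abs_of_mem_Lam (hρ : 2 < ρ) (hc : ∀ n k, c n k ≠ 0)
    (hlac : ∀ k, LacunaryBy ρ fun n => (c n k : ℝ)) (hq : q ∈ Lam c) (k : Fin 2) :
    1 ≤ |(q k : ℝ)| := by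
  obtain ⟨j, hj⟩ := exists_coord_comparable_of_mem_Lam (by linarith) hlac hq
  have hcj : 0 < |(c j k : ℝ)| := abs_pos.mpr (Int.cast_ne_zero.mpr (hc j k))
  have hqk : q k ≠ 0 := fun h => by
    have := (hj k).1
    rw [h, Int.cast_zero, abs_zero, mul_zero] at this
    exact this.not_gt (mul_pos (by linarith) hcj)
  exact_mod_cast Int.one_le_abs hqk

lemma abs_snd_le_of_mem_Lam {δ : ℝ} (hρ : 2 < ρ) (hδ : 0 ≤ δ)
    (hslope : ∀ n, |(c n 1 : ℝ)| ≤ δ * |(c n 0 : ℝ)|)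
    (hlac : ∀ k, LacunaryBy ρ fun n => (c n k : ℝ)) (hq : q ∈ Lam c) :
    |(q 1 : ℝ)| ≤ ρ / (ρ - 2) * δ * |(q 0 : ℝ)| := by
  obtain ⟨j, hj⟩ := exists_coord_comparable_of_mem_Lam (by linarith) hlac hq
  have hρ1 : 0 < ρ - 1 := by linarith
  have hρ2 : 0 < ρ - 2 := by linarith
  refine le_of_mul_le_mul_left ?_ hρ1
  calc (ρ - 1) * |(q 1 : ℝ)| ≤ ρ * |(c j 1 : ℝ)| := (hj 1).2
    _ ≤ ρ * (δ * |(c j 0 : ℝ)|) := by gcongr; exact hslope j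
    _ = ρ / (ρ - 2) * δ * ((ρ - 2) * |(c j 0 : ℝ)|) := by field_simp
    _ ≤ ρ / (ρ - 2) * δ * ((ρ - 1) * |(q 0 : ℝ)|) :=
        mul_le_mul_of_nonneg_left (hj 0).1 (by positivity)
    _ = (ρ - 1) * (ρ / (ρ - 2) * δ * |(q 0 : ℝ)|) := by ring

lemma sum_signType_half_pow_card_ne_zero (ι : Type*) [Fintype ι] [DecidableEq ι] :
    ∑ ζ : ι → SignType, (1 / 2 : ℝ) ^ (Finset.univ.filter fun j => ζ j ≠ 0).card =
      2 ^ Fintype.card ι := by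
  have hprod (ζ : ι → SignType) :
      (1 / 2 : ℝ) ^ (Finset.univ.filter fun j => ζ j ≠ 0).card =
        ∏ j, if ζ j ≠ 0 then (1 / 2 : ℝ) else 1 := by
    rw [Finset.prod_ite, Finset.prod_const, Finset.prod_const_one, mul_one]
  have hsum : ∑ σ : SignType, (if σ ≠ 0 then (1 / 2 : ℝ) else 1) = 2 := by
    rw [SignType.univ_eq, Finset.sum_insert (by decide), Finset.sum_insert (by decide),
      Finset.sum_singleton]
    norm_num
  simp only [hprod]
  rw [← Fintype.prod_sum fun (_ : ι) (σ : SignType) => if σ ≠ 0 then (1 / 2 : ℝ) else 1]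
  simp only [hsum, Finset.prod_const, Finset.card_univ]

lemma sum_Lam_half_pow_chi_le (c : Fin s → Fin 2 → ℤ) :
    ∑ q ∈ Lam c, (1 / 2 : ℝ) ^ chi c q ≤ 2 ^ s := by
  classical
  have hrep : ∀ q ∈ Lam c, ∃ ζ, comb c ζ = q ∧
      chi c q = (Finset.univ.filter fun j => ζ j ≠ 0).card := fun q hq => by
    obtain ⟨ζ, -, hζ⟩ := exists_comb_eq_of_mem_Lam hq
    have h : ∃ ζ, comb c ζ = q := ⟨ζ, hζ⟩
    exact ⟨h.choose, h.choose_spec, by rw [chi, dif_pos h]⟩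
  choose! rep hcomb hchi using hrep
  have hinj : Set.InjOn rep (Lam c) := fun q hq q' hq' h => by
    rw [← hcomb q hq, h, hcomb q' hq']
  calc ∑ q ∈ Lam c, (1 / 2 : ℝ) ^ chi c q
      = ∑ ζ ∈ (Lam c).image rep, (1 / 2 : ℝ) ^ (Finset.univ.filter fun j => ζ j ≠ 0).card := by
        rw [Finset.sum_image hinj]
        exact Finset.sum_congr rfl fun q hq => by rw [hchi q hq]
    _ ≤ ∑ ζ : Fin s → SignType, (1 / 2 : ℝ) ^ (Finset.univ.filter fun j => ζ j ≠ 0).card :=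
        Finset.sum_le_sum_of_subset_of_nonneg (Finset.subset_univ _) fun _ _ _ => by positivity
    _ = 2 ^ s := by rw [sum_signType_half_pow_card_ne_zero, Fintype.card_fin]

lemma ratioH_eq_sum (c : Fin s → Fin 2 → ℤ) (θ : ℕ) :
    ratioH c θ = ∑ q ∈ Lam c, (((1 / 2 : ℝ) ^ chi c q : ℝ) : ℂ) •
      fun ξ : Plane => ((ξ 1 / ξ 0 * G ((2 : ℝ) ^ θ • (ξ - toPlane q)) : ℝ) : ℂ) := by
  funext ξ
  rw [ratioH, H, Finset.mul_sum, Complex.ofReal_sum, Finset.sum_apply]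
  refine Finset.sum_congr rfl fun q _ => ?_
  rw [Pi.smul_apply, smul_eq_mul, ← Complex.ofReal_mul, one_div_pow]
  ring_nf

lemma hasFourierL1Bound_ratio_mul_G_of_mem_Lam {r δ : ℝ} (hr : 2 ≤ r) (hρ : 2 < ρ) (hδ : 0 ≤ δ)
    (hc : ∀ n k, c n k ≠ 0) (hslope : ∀ n, |(c n 1 : ℝ)| ≤ δ * |(c n 0 : ℝ)|)
    (hlac : ∀ k, LacunaryBy ρ fun n => (c n k : ℝ)) (hq : q ∈ Lam c) :
    HasFourierL1Bound (fun ξ : Plane => ((ξ 1 / ξ 0 * G (r • (ξ - toPlane q)) : ℝ) : ℂ))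
      (128 * pi ^ 2 * (ρ / (ρ - 2)) * δ) := by
  have hq0 : 1 ≤ |(q 0 : ℝ)| := one_le_abs_of_mem_Lam hρ hc hlac hq 0
  have hq1 : 1 ≤ |(q 1 : ℝ)| := one_le_abs_of_mem_Lam hρ hc hlac hq 1
  refine (hasFourierL1Bound_ratio_mul_G hr (q := toPlane q) hq0).mono ?_
  have hratio : (|(q 1 : ℝ)| + 1) / |(q 0 : ℝ)| ≤ 2 * (ρ / (ρ - 2) * δ) := by
    rw [div_le_iff₀ (by linarith)]
    linarith [abs_snd_le_of_mem_Lam hρ hδ hslope hlac hq]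
  exact (mul_le_mul_of_nonneg_left hratio (by positivity)).trans_eq (by ring)

lemma Admissible.abs_snd_le {N : ℝ} (hc : Admissible s N c) (n : Fin s) :
    |(c n 1 : ℝ)| ≤ 1 / 2 ^ s * |(c n 0 : ℝ)| := by
  have hs : (1 : ℝ) ≤ s := by exact_mod_cast n.pos
  rw [← div_le_iff₀ (abs_pos.mpr (Int.cast_ne_zero.mpr (hc.off_axes n 0)))]
  refine (hc.slope n).trans (one_div_le_one_div_of_le (by positivity) ?_)
  calc (2 : ℝ) ^ s ≤ 3 ^ s := by gcongr; norm_num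
    _ ≤ 3 ^ (s + 2) := pow_le_pow_right₀ (by norm_num) (Nat.le_add_right s 2)
    _ ≤ 3 ^ (s + 2) * s := le_mul_of_one_le_right (by positivity) hs

lemma Admissible.lacunaryBy {N : ℝ} (hc : Admissible s N c) (k : Fin 2) :
    LacunaryBy (2 ^ N) fun n => (c n k : ℝ) := fun n m hnm => by
  have h := (hc.lacunary n m hnm k).le
  rwa [Real.rpow_neg zero_le_two, ← div_eq_inv_mul, le_div_iff₀' (by positivity)] at h

end Frequencies

end RieszBump

open RieszBump in
theorem mainTheorem4_general {s θ : ℕ} {κ ρ : ℝ} {c : Fin s → Fin 2 → ℤ} (hθ : 1 ≤ θ)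
    (hκ : 0 ≤ κ) (hρ : 2 < ρ) (off_axes : ∀ n i, c n i ≠ 0)
    (slope : ∀ n, |(c n 1 : ℝ)| ≤ κ / 2 ^ s * |(c n 0 : ℝ)|)
    (lacunary : ∀ i, LacunaryBy ρ fun n => (c n i : ℝ)) :
    HasFourierL1Bound (ratioH c θ) (128 * Real.pi ^ 2 * (ρ / (ρ - 2)) * κ) := by
  have hρ2 : 0 < ρ - 2 := sub_pos.mpr hρ
  have hθ2 : (2 : ℝ) ≤ 2 ^ θ := le_self_pow₀ one_le_two (Nat.one_le_iff_ne_zero.mp hθ)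
  rw [ratioH_eq_sum]
  refine (HasFourierL1Bound.sum fun q hq => (hasFourierL1Bound_ratio_mul_G_of_mem_Lam hθ2 hρ
    (by positivity) off_axes slope lacunary hq).const_smul _).mono ?_
  simp only [Complex.norm_real, Real.norm_of_nonneg (by positivity : (0 : ℝ) ≤ (1 / 2) ^ _)]
  set A : ℝ := 128 * Real.pi ^ 2 * (ρ / (ρ - 2)) * (κ / 2 ^ s) with hA
  calc ∑ q ∈ Lam c, (1 / 2 : ℝ) ^ chi c q * A ≤ 2 ^ s * A := by
        rw [← Finset.sum_mul]
        exact mul_le_mul_of_nonneg_right (sum_Lam_half_pow_chi_le c) (by positivity)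
    _ = 128 * Real.pi ^ 2 * (ρ / (ρ - 2)) * κ := by
        rw [hA]
        field_simp

theorem mainTheorem4 :
    ∃ C : ℝ, ∀ s : ℕ, 1 ≤ s → ∃ θ : ℕ, 1 ≤ θ ∧
      ∀ (N : ℝ) (c : Fin s → Fin 2 → ℤ), 2 ≤ N → RieszBump.Admissible s N c →
        Integrable (RieszBump.ratioH c θ) volume ∧
        Integrable (𝓕⁻ (RieszBump.ratioH c θ)) volume ∧
        ∫ x, ‖𝓕⁻ (RieszBump.ratioH c θ) x‖ ≤ C := by
  refine ⟨128 * Real.pi ^ 2 * (4 / (4 - 2)) * 1, fun s _ => ⟨1, le_rfl, fun N c hN hc => ?_⟩⟩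
  have hN4 : (4 : ℝ) ≤ 2 ^ N := by
    calc (4 : ℝ) = 2 ^ (2 : ℝ) := by norm_num
      _ ≤ 2 ^ N := Real.rpow_le_rpow_of_exponent_le one_le_two hN
  obtain ⟨hf, hF, hB⟩ := mainTheorem4_general le_rfl zero_le_one (by norm_num : (2 : ℝ) < 4)
    hc.off_axes hc.abs_snd_le fun i => (hc.lacunaryBy i).mono hN4
  exact ⟨hf, hF, hB⟩
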